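/- Let $n\ge 0$ be an integer and let $h:[0,\infty)\to[0,\infty)$ be a continuous nondecreasing function with $h(0)=0$. For $E\subset\mathbb R^n$ and $\delta>0$ put $$\mathcal H^h_\delta(E)=\inf\Big\{\sum_{i=1}^\infty h(\operatorname{diam}(C_i))\;:\;\operatorname{diam}(C_i)\le\delta,\ E\subset\bigcup_{i=1}^\infty C_i\Big\},\qquad \mathcal H^h(E)=\lim_{\delta\downarrow 0}\mathcal H^h_\delta(E).$$ A dyadic cube is a closed cube $Q=\prod_{i=1}^n[k_i2^{-j},(k_i+1)2^{-j}]$ with $j,k_1,\dots,k_n\in\mathbb Z$. If $E\subset\mathbb R^n$ is an analytic (Souslin) set with $\mathcal H^h(E)>0$, then there is a Radon measure $\mu$ on $\mathbb R^n$ such that $\mu(E)>0$ and $\mu(Q)\le h(\operatorname{diam}(Q))$ for every dyadic cube $Q$. -/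

import Mathlib

open scoped ENNReal

noncomputable section

/-- The size-`δ` approximation
`H_δ^h(E) = inf { ∑ h (diam C_i) | diam C_i ≤ δ, E ⊆ ⋃ C_i }`.
The bound is imposed on the extended diameter, so unbounded sets are never admitted. -/
def hausdorffPre {X : Type*} [MetricSpace X] (h : ℝ → ℝ) (δ : ℝ) (E : Set X) : ℝ≥0∞ :=
  ⨅ (C : ℕ → Set X) (_ : ∀ i, Metric.ediam (C i) ≤ ENNReal.ofReal δ) (_ : E ⊆ ⋃ i, C i),
    ∑' i, ENNReal.ofReal (h (Metric.diam (C i)))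

/-- The generalized Hausdorff measure `H^h(E) = lim_{δ → 0} H_δ^h(E)`. Since `H_δ^h(E)` grows
as `δ > 0` decreases, the limit is the supremum over `δ > 0`. -/
def generalizedHausdorff {X : Type*} [MetricSpace X] (h : ℝ → ℝ) (E : Set X) : ℝ≥0∞ :=
  ⨆ (δ : ℝ) (_ : 0 < δ), hausdorffPre h δ E

/-- The closed dyadic cube `∏ i, [k_i 2^{-j}, (k_i + 1) 2^{-j}]` in `ℝⁿ`, of side `2^{-j}`. -/
def dyadicCube {n : ℕ} (j : ℤ) (k : Fin n → ℤ) : Set (EuclideanSpace ℝ (Fin n)) :=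
  {x | ∀ i, (k i : ℝ) * (2 : ℝ) ^ (-j) ≤ x i ∧ x i ≤ ((k i : ℝ) + 1) * (2 : ℝ) ^ (-j)}

/-- `Q` is a closed dyadic cube of `ℝⁿ` (of side `2^{-j}` for some integer `j`). -/
def IsDyadicCube {n : ℕ} (Q : Set (EuclideanSpace ℝ (Fin n))) : Prop :=
  ∃ (j : ℤ) (k : Fin n → ℤ), Q = dyadicCube j k

end

/-! Let `M` be the infimum of the costs of covers by half-open dyadic cubes of side at most one.
These cubes are nested or disjoint, and this tree structure replaces Frostman's usual stopping-time
construction. Nestedness makes `M` strongly subadditive and continuous along increasing sequences of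
arbitrary sets. Continuity drives Choquet's capacitability argument, which reduces an analytic set
to a compact `K` with `M K ≠ 0`. Strong subadditivity gives, at each level, a discrete measure on
`K` of mass `M K` dominated by `M` (`exists_mass_le_cellContent`); a weak limit of these is the
measure sought. Half-open cubes are neither open nor closed, so both compactness arguments pass
through an open neighbourhood of a cube covered by its `3 ^ n` neighbours of the same side. The
final measure is therefore divided by `3 ^ n`. -/

open MeasureTheory Set Filter Topology

/-! ### Contents generated by a refining sequence of partitions. -/

section Content

variable {X κ : Type*}

/-- The union of the cells `{x | c j x = k}` indexed by the pairs `(j, k) ∈ S`. -/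
def cellUnion (c : ℕ → X → κ) (S : Set (ℕ × κ)) : Set X := {x | ∃ j, (j, c j x) ∈ S}

/-- The pairs in `S` whose cell is maximal among the cells indexed by `S`. -/
def cellRoots (c : ℕ → X → κ) (S : Set (ℕ × κ)) : Set (ℕ × κ) :=
  {q | q ∈ S ∧ ∃ x, c q.1 x = q.2 ∧ ∀ i < q.1, (i, c i x) ∉ S}

/-- The partitions of `X` into the fibres of `c j` become finer as `j` grows. -/
def IsRefining (c : ℕ → X → κ) : Prop :=
  ∀ ⦃i j : ℕ⦄, i ≤ j → ∀ ⦃x y : X⦄, c j x = c j y → c i x = c i y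

/-- The infimum of the costs of the covers of `A` by cells. -/
noncomputable def cellContent [MeasurableSpace κ] (c : ℕ → X → κ) (ρ : Measure (ℕ × κ)) (A : Set X) : ℝ≥0∞ :=
  ⨅ (S : Set (ℕ × κ)) (_ : A ⊆ cellUnion c S), ρ S

variable {c : ℕ → X → κ}

lemma cellUnion_mono {S T : Set (ℕ × κ)} (h : S ⊆ T) : cellUnion c S ⊆ cellUnion c T :=
  fun _ ⟨j, hj⟩ => ⟨j, h hj⟩

lemma cellRoots_subset (S : Set (ℕ × κ)) : cellRoots c S ⊆ S := fun _ h => h.1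

lemma cellUnion_subset_cellUnion_cellRoots (S : Set (ℕ × κ)) :
    cellUnion c S ⊆ cellUnion c (cellRoots c S) := by
  classical
  intro x hx
  exact ⟨Nat.find hx, Nat.find_spec hx, x, rfl, fun i hi => Nat.find_min hx hi⟩

/-- All points of a root see the same coarser cells, so maximality at its witness holds at `x` too.
Hence distinct roots are disjoint. -/
lemma IsRefining.le_of_mem_cellRoots (hc : IsRefining c) {S : Set (ℕ × κ)} {i j : ℕ} {x : X}
    (hj : (j, c j x) ∈ cellRoots c S) (hi : (i, c i x) ∈ S) : j ≤ i := by
  obtain ⟨-, y, hy, hmin⟩ := hj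
  by_contra! hij
  refine hmin i hij ?_
  rwa [hc hij.le hy]

variable [MeasurableSpace κ] {ρ : Measure (ℕ × κ)}

lemma cellContent_le {A : Set X} {S : Set (ℕ × κ)} (h : A ⊆ cellUnion c S) :
    cellContent c ρ A ≤ ρ S := iInf₂_le S h

lemma exists_cover_lt {A : Set X} {r : ℝ≥0∞} (h : cellContent c ρ A < r) :
    ∃ S, A ⊆ cellUnion c S ∧ ρ S < r := by
  simpa [cellContent, iInf_lt_iff] using h

lemma exists_cover_le {A : Set X} (hA : cellContent c ρ A ≠ ∞) {ε : ℝ≥0∞} (hε : ε ≠ 0) :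
    ∃ S, A ⊆ cellUnion c S ∧ ρ S ≤ cellContent c ρ A + ε := by
  obtain ⟨S, hS, h⟩ := exists_cover_lt (ENNReal.lt_add_right hA hε)
  exact ⟨S, hS, h.le⟩

lemma cellContent_mono {A B : Set X} (h : A ⊆ B) : cellContent c ρ A ≤ cellContent c ρ B :=
  le_iInf₂ fun _ hS => cellContent_le (h.trans hS)

lemma cellContent_union_le (A B : Set X) :
    cellContent c ρ (A ∪ B) ≤ cellContent c ρ A + cellContent c ρ B := by
  refine ENNReal.le_of_forall_pos_le_add fun ε hε hfin => ?_
  have hε2 : (ε / 2 : ℝ≥0∞) ≠ 0 := by simpa using hε.ne'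
  obtain ⟨S, hS, hS'⟩ := exists_cover_le (c := c) (ρ := ρ) (A := A)
    (ne_top_of_le_ne_top hfin.ne le_self_add) hε2
  obtain ⟨T, hT, hT'⟩ := exists_cover_le (c := c) (ρ := ρ) (A := B)
    (ne_top_of_le_ne_top hfin.ne le_add_self) hε2
  calc cellContent c ρ (A ∪ B) ≤ ρ (S ∪ T) := cellContent_le
        (union_subset (hS.trans (cellUnion_mono subset_union_left))
          (hT.trans (cellUnion_mono subset_union_right)))
    _ ≤ ρ S + ρ T := measure_union_le _ _
    _ ≤ _ := add_le_add hS' hT'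
    _ = cellContent c ρ A + cellContent c ρ B + (ε / 2 + ε / 2) := by ring
    _ = _ := by rw [ENNReal.add_halves]

lemma cellContent_iUnion_eq_zero {ι : Type*} [Countable ι] {A : ι → Set X}
    (h : ∀ i, cellContent c ρ (A i) = 0) : cellContent c ρ (⋃ i, A i) = 0 := by
  rw [← nonpos_iff_eq_zero]
  refine ENNReal.le_of_forall_pos_le_add fun ε hε _ => ?_
  obtain ⟨ε', hε', hsum⟩ := ENNReal.exists_pos_sum_of_countable'
    (ENNReal.coe_ne_zero.2 hε.ne') ι
  choose S hS hS' using fun i => exists_cover_le (c := c) (ρ := ρ) (A := A i) (by simp [h i])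
    (hε' i).ne'
  calc cellContent c ρ (⋃ i, A i) ≤ ρ (⋃ i, S i) := cellContent_le
        (iUnion_subset fun i => (hS i).trans (cellUnion_mono (subset_iUnion S i)))
    _ ≤ ∑' i, ρ (S i) := measure_iUnion_le _
    _ ≤ ∑' i, ε' i := ENNReal.tsum_le_tsum fun i => by simpa [h i] using hS' i
    _ ≤ 0 + ε := by simpa using hsum.le

/-- The content is strongly subadditive. -/
lemma IsRefining.cellContent_union_add_inter_le [DiscreteMeasurableSpace (ℕ × κ)]
    (hc : IsRefining c) (A B : Set X) :
    cellContent c ρ (A ∪ B) + cellContent c ρ (A ∩ B)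
      ≤ cellContent c ρ A + cellContent c ρ B := by
  have key : ∀ S T : Set (ℕ × κ), A ⊆ cellUnion c S → B ⊆ cellUnion c T →
      cellContent c ρ (A ∪ B) + cellContent c ρ (A ∩ B) ≤ ρ S + ρ T := by
    intro S T hS hT
    set R := cellRoots c S
    have hR : A ⊆ cellUnion c R := hS.trans (cellUnion_subset_cellUnion_cellRoots S)
    -- `P`: cells inside a cell of `T`, equality allowed; `Q`: cells strictly inside a root. The
    -- outer cells of `R` and `T` cover the union, the inner ones the intersection. The asymmetry
    -- `≤` / `<` puts a common cell once in each cover.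
    set P : Set (ℕ × κ) := {q | ∃ x, c q.1 x = q.2 ∧ ∃ i ≤ q.1, (i, c i x) ∈ T}
    set Q : Set (ℕ × κ) := {q | ∃ x, c q.1 x = q.2 ∧ ∃ i < q.1, (i, c i x) ∈ R}
    have hRx : ∀ x i, (i, c i x) ∈ R → x ∈ cellUnion c ((R \ P) ∪ (T \ Q)) := by
      intro x i hi
      by_cases hP : (i, c i x) ∈ P
      · obtain ⟨y, hy, j, hj, hjT⟩ := hP
        rw [hc hj hy] at hjT
        refine ⟨j, Or.inr ⟨hjT, ?_⟩⟩
        rintro ⟨z, hz, l, hl, hlR⟩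
        rw [hc hl.le hz] at hlR
        exact absurd (hc.le_of_mem_cellRoots hi hlR.1) (by simp at hl; omega)
      · exact ⟨i, Or.inl ⟨hi, hP⟩⟩
    have h1 : A ∪ B ⊆ cellUnion c ((R \ P) ∪ (T \ Q)) := by
      rintro x (hx | hx)
      · obtain ⟨i, hi⟩ := hR hx
        exact hRx x i hi
      · obtain ⟨j, hj⟩ := hT hx
        by_cases hQ : (j, c j x) ∈ Q
        · obtain ⟨y, hy, i, hi, hiR⟩ := hQ
          rw [hc hi.le hy] at hiR
          exact hRx x i hiR
        · exact ⟨j, Or.inr ⟨hj, hQ⟩⟩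
    have h2 : A ∩ B ⊆ cellUnion c ((R ∩ P) ∪ (T ∩ Q)) := by
      rintro x ⟨hxA, hxB⟩
      obtain ⟨i, hi⟩ := hR hxA
      obtain ⟨j, hj⟩ := hT hxB
      rcases le_or_gt j i with hji | hij
      · exact ⟨i, Or.inl ⟨hi, x, rfl, j, hji, hj⟩⟩
      · exact ⟨j, Or.inr ⟨hj, x, rfl, i, hij, hi⟩⟩
    calc cellContent c ρ (A ∪ B) + cellContent c ρ (A ∩ B)
        ≤ (ρ (R \ P) + ρ (T \ Q)) + (ρ (R ∩ P) + ρ (T ∩ Q)) :=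
          add_le_add ((cellContent_le h1).trans (measure_union_le _ _))
            ((cellContent_le h2).trans (measure_union_le _ _))
      _ = (ρ (R ∩ P) + ρ (R \ P)) + (ρ (T ∩ Q) + ρ (T \ Q)) := by ring
      _ = ρ R + ρ T := by
          rw [measure_inter_add_sdiff R (MeasurableSet.of_discrete (s := P)),
            measure_inter_add_sdiff T (MeasurableSet.of_discrete (s := Q))]
      _ ≤ ρ S + ρ T := by gcongr; exact cellRoots_subset S
  refine ENNReal.le_of_forall_pos_le_add fun ε hε hfin => ?_
  have hε2 : (ε / 2 : ℝ≥0∞) ≠ 0 := by simpa using hε.ne'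
  obtain ⟨S, hS, hS'⟩ := exists_cover_le (c := c) (ρ := ρ) (A := A)
    (ne_top_of_le_ne_top hfin.ne le_self_add) hε2
  obtain ⟨T, hT, hT'⟩ := exists_cover_le (c := c) (ρ := ρ) (A := B)
    (ne_top_of_le_ne_top hfin.ne le_add_self) hε2
  calc _ ≤ ρ S + ρ T := key S T hS hT
    _ ≤ _ := add_le_add hS' hT'
    _ = cellContent c ρ A + cellContent c ρ B + (ε / 2 + ε / 2) := by ring
    _ = _ := by rw [ENNReal.add_halves]

/-- The content is continuous along increasing sequences of arbitrary sets. -/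
lemma IsRefining.cellContent_iUnion_le [DiscreteMeasurableSpace (ℕ × κ)]
    (hc : IsRefining c) {E : ℕ → Set X} (hE : Monotone E) {r : ℝ≥0∞}
    (hr : ∀ k, cellContent c ρ (E k) ≤ r) : cellContent c ρ (⋃ k, E k) ≤ r := by
  refine ENNReal.le_of_forall_pos_le_add fun ε hε hfin => ?_
  have hε2 : (ε / 2 : ℝ≥0∞) ≠ 0 := by simpa using hε.ne'
  obtain ⟨δ, hδ, hsum⟩ := ENNReal.exists_pos_sum_of_countable' hε2 ℕ
  have hEfin : ∀ k, cellContent c ρ (E k) ≠ ∞ := fun k => ne_top_of_le_ne_top hfin.ne (hr k)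
  choose S hS hS' using fun k => exists_cover_le (hEfin k) (hδ k).ne'
  set T := cellRoots c (⋃ k, S k)
  -- Each root is charged to the first cover `S k` in which it occurs.
  set F : ℕ → Set (ℕ × κ) := fun k => T ∩ disjointed S k
  have hFS : ∀ k, F k ⊆ S k := fun k => inter_subset_right.trans (disjointed_subset S k)
  have hTF : T = ⋃ k, F k := by
    rw [← inter_iUnion, iUnion_disjointed, inter_eq_left.2 (cellRoots_subset _)]
  have hcover : ⋃ k, E k ⊆ cellUnion c T :=
    (iUnion_subset fun k => (hS k).trans (cellUnion_mono (subset_iUnion S k))).trans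
      (cellUnion_subset_cellUnion_cellRoots _)
  -- Since `S k` is optimal up to `δ k`, so is its part `F k` for the piece of `E k` it covers.
  have hF : ∀ k, ρ (F k) ≤ cellContent c ρ (E k ∩ cellUnion c (F k)) + δ k := by
    intro k
    have h1 : cellContent c ρ (E k)
        ≤ cellContent c ρ (E k ∩ cellUnion c (F k)) + ρ (S k \ F k) := by
      refine (cellContent_mono ?_).trans ((cellContent_union_le _ (cellUnion c (S k \ F k))).trans
        (add_le_add_right (cellContent_le subset_rfl) _))
      intro x hx
      obtain ⟨j, hj⟩ := hS k hx
      by_cases hjF : (j, c j x) ∈ F k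
      · exact Or.inl ⟨hx, j, hjF⟩
      · exact Or.inr ⟨j, hj, hjF⟩
    have h2 : ρ (F k) + ρ (S k \ F k) ≤ cellContent c ρ (E k) + δ k := by
      refine le_trans (le_of_eq ?_) (hS' k)
      rw [← measure_inter_add_sdiff (S k) (MeasurableSet.of_discrete (s := F k)),
        inter_eq_right.2 (hFS k)]
    have h3 : ρ (S k \ F k) ≠ ∞ :=
      ne_top_of_le_ne_top (ENNReal.add_ne_top.2 ⟨hEfin k, (lt_of_le_of_lt
        ((ENNReal.le_tsum k).trans hsum.le) (by finiteness)).ne⟩) (le_add_self.trans h2)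
    refine (ENNReal.add_le_add_iff_right h3).1 (h2.trans ?_)
    calc _ ≤ _ := add_le_add_left h1 (δ k)
      _ = _ := by ring
  have hpart : ∀ m, ∑ k ∈ Finset.range (m + 1), ρ (F k) ≤ r + ε := by
    intro m
    -- As roots are maximal, `S m` covers the piece belonging to `F k` by cells below `F k`. For
    -- different `k` these are disjoint subfamilies of `S m`, so the `F k` with `k ≤ m` together
    -- cost little more than `S m`.
    set D : ℕ → Set (ℕ × κ) := fun k =>
      {p | p ∈ S m ∧ ∃ x, c p.1 x = p.2 ∧ ∃ i ≤ p.1, (i, c i x) ∈ F k}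
    have hD : ∀ k ∈ Finset.range (m + 1),
        cellContent c ρ (E k ∩ cellUnion c (F k)) ≤ ρ (D k) := by
      intro k hk
      refine cellContent_le ?_
      rintro x ⟨hx, i, hi⟩
      obtain ⟨j, hj⟩ := hS m (hE (Finset.mem_range_succ_iff.1 hk) hx)
      exact ⟨j, hj, x, rfl, i, hc.le_of_mem_cellRoots hi.1 (mem_iUnion.2 ⟨m, hj⟩), hi⟩
    have hdisj : Pairwise fun k l => Disjoint (D k) (D l) := by
      intro k l hkl
      refine disjoint_left.2 ?_
      rintro p ⟨-, x, hx, i, hi, hiF⟩ ⟨-, y, hy, j, hj, hjF⟩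
      have hxy : c p.1 x = c p.1 y := hx.trans hy.symm
      rw [hc hi hxy] at hiF
      have hij : i = j := le_antisymm
        (hc.le_of_mem_cellRoots hiF.1 (cellRoots_subset _ hjF.1))
        (hc.le_of_mem_cellRoots hjF.1 (cellRoots_subset _ hiF.1))
      subst hij
      exact disjoint_left.1 (disjoint_disjointed S hkl) hiF.2 hjF.2
    calc ∑ k ∈ Finset.range (m + 1), ρ (F k)
        ≤ ∑ k ∈ Finset.range (m + 1), (ρ (D k) + δ k) :=
          Finset.sum_le_sum fun k hk => (hF k).trans (add_le_add_left (hD k hk) _)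
      _ = ρ (⋃ k ∈ Finset.range (m + 1), D k) + ∑ k ∈ Finset.range (m + 1), δ k := by
          rw [Finset.sum_add_distrib, measure_biUnion_finset
            (fun k _ l _ hkl => hdisj hkl) fun _ _ => MeasurableSet.of_discrete]
      _ ≤ ρ (S m) + ∑' k, δ k :=
          add_le_add (measure_mono (iUnion₂_subset fun k _ => fun p hp => hp.1))
            (ENNReal.sum_le_tsum _)
      _ ≤ (r + ε / 2) + ε / 2 := by
          refine add_le_add ((hS' m).trans (add_le_add (hr m) ?_)) hsum.le
          exact (ENNReal.le_tsum m).trans hsum.le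
      _ = r + ε := by rw [add_assoc, ENNReal.add_halves]
  calc cellContent c ρ (⋃ k, E k) ≤ ρ T := cellContent_le hcover
    _ ≤ ∑' k, ρ (F k) := by rw [hTF]; exact measure_iUnion_le _
    _ ≤ r + ε := by
        refine ENNReal.tsum_le_of_sum_range_le fun m => ?_
        cases m with
        | zero => simp
        | succ m => exact hpart m

/-- Strong subadditivity yields a mass distribution on a finite family of sets which is dominated
by the content and has full mass. -/
lemma IsRefining.exists_mass_le_cellContent [DiscreteMeasurableSpace (ℕ × κ)] {ι : Type*}
    (hc : IsRefining c) (A : ι → Set X) (P : Finset ι)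
    (hfin : cellContent c ρ (⋃ i ∈ P, A i) ≠ ∞) :
    ∃ a : ι → ℝ≥0∞, ∑ i ∈ P, a i = cellContent c ρ (⋃ i ∈ P, A i) ∧
      ∀ F ⊆ P, ∑ i ∈ F, a i ≤ cellContent c ρ (⋃ i ∈ F, A i) := by
  classical
  induction P using Finset.induction_on with
  | empty =>
    have h0 : cellContent c ρ (∅ : Set X) = 0 :=
      nonpos_iff_eq_zero.1 ((cellContent_le (empty_subset _)).trans (measure_empty (μ := ρ)).le)
    exact ⟨0, by simp [h0], fun F hF => by simp [Finset.subset_empty.1 hF]⟩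
  | insert q P hq ih =>
    have hle : cellContent c ρ (⋃ i ∈ P, A i) ≤ cellContent c ρ (⋃ i ∈ insert q P, A i) :=
      cellContent_mono (biUnion_subset_biUnion_left fun i hi => Finset.mem_insert_of_mem hi)
    have hPfin := ne_top_of_le_ne_top hfin hle
    obtain ⟨a, ha, ha'⟩ := ih hPfin
    -- Greedy choice: the new set receives its marginal content. Strong subadditivity says that
    -- marginals only decrease as the family grows, which preserves domination.
    set b := Function.update a q
      (cellContent c ρ (⋃ i ∈ insert q P, A i) - cellContent c ρ (⋃ i ∈ P, A i))
    have hb : ∀ F ⊆ P, ∑ i ∈ F, b i = ∑ i ∈ F, a i := fun F hF =>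
      Finset.sum_congr rfl fun i hi => Function.update_of_ne (by rintro rfl; exact hq (hF hi)) _ _
    have hbq : b q + cellContent c ρ (⋃ i ∈ P, A i)
        = cellContent c ρ (⋃ i ∈ insert q P, A i) := by
      simp only [b, Function.update_self]
      exact tsub_add_cancel_of_le hle
    refine ⟨b, ?_, fun F hF => ?_⟩
    · rw [Finset.sum_insert hq, hb P subset_rfl, ha, hbq]
    · by_cases hqF : q ∈ F
      · have hF' : F.erase q ⊆ P := by
          intro i hi
          exact Finset.mem_of_mem_insert_of_ne (hF (Finset.mem_of_mem_erase hi))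
            (Finset.ne_of_mem_erase hi)
        rw [← Finset.add_sum_erase F b hqF, hb _ hF']
        refine (ENNReal.add_le_add_iff_right hPfin).1 ?_
        calc b q + ∑ i ∈ F.erase q, a i + cellContent c ρ (⋃ i ∈ P, A i)
            = cellContent c ρ (⋃ i ∈ insert q P, A i) + ∑ i ∈ F.erase q, a i := by
              rw [← hbq]; ring
          _ ≤ cellContent c ρ ((⋃ i ∈ F, A i) ∪ ⋃ i ∈ P, A i)
              + cellContent c ρ ((⋃ i ∈ F, A i) ∩ ⋃ i ∈ P, A i) := by
              refine add_le_add (cellContent_mono ?_) ((ha' _ hF').trans (cellContent_mono ?_))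
              · refine iUnion₂_subset fun i hi => ?_
                rcases Finset.mem_insert.1 hi with rfl | hi
                · exact (subset_biUnion_of_mem (u := A) (s := (F : Set ι)) hqF).trans
                    subset_union_left
                · exact (subset_biUnion_of_mem (u := A) (s := (P : Set ι)) hi).trans
                    subset_union_right
              · exact subset_inter
                  (biUnion_subset_biUnion_left fun i hi => Finset.mem_of_mem_erase hi)
                  (biUnion_subset_biUnion_left hF')
          _ ≤ _ := hc.cellContent_union_add_inter_le _ _
      · have hF' : F ⊆ P := fun i hi =>
          Finset.mem_of_mem_insert_of_ne (hF hi) (by rintro rfl; exact hqF hi)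
        rw [hb F hF']
        exact ha' F hF'

end Content

/-! ### Capacitability of analytic sets. -/

section Capacity

/-- If a monotone set function is continuous along increasing sequences and exceeds `a` on the
range of a map defined on `ℕ → ℕ`, then it exceeds `a` on the images of boxes with finitely many
bounded coordinates. -/
lemma exists_bounds_lt_image {X : Type*} {M : Set X → ℝ≥0∞}
    (hM : ∀ (A : ℕ → Set X) (r : ℝ≥0∞), Monotone A → (∀ k, M (A k) ≤ r) → M (⋃ k, A k) ≤ r)
    (f : (ℕ → ℕ) → X) {a : ℝ≥0∞} (ha : a < M (range f)) :
    ∃ b : ℕ → ℕ, ∀ k, a < M (f '' {σ | ∀ i < k, σ i ≤ b i}) := by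
  -- Coordinates are bounded one at a time: if no bound `v` worked, continuity along the increasing
  -- union over `v` would be violated.
  have step : ∀ (k : ℕ) (A : {A : Set (ℕ → ℕ) // a < M (f '' A)}),
      ∃ v, a < M (f '' (A.1 ∩ {σ | σ k ≤ v})) := by
    rintro k ⟨A, hA⟩
    by_contra! hcon
    refine hA.not_ge ?_
    have hU : f '' A = ⋃ v, f '' (A ∩ {σ | σ k ≤ v}) := by
      rw [← image_iUnion, ← inter_iUnion]
      congr 1
      exact (inter_eq_left.2 fun σ _ => mem_iUnion.2 ⟨σ k, le_refl (σ k)⟩).symm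
    rw [hU]
    exact hM _ _ (fun v w hvw => image_mono (inter_subset_inter_right _
      fun σ (hσ : σ k ≤ v) => hσ.trans hvw)) hcon
  choose v hv using step
  let B : ℕ → {A : Set (ℕ → ℕ) // a < M (f '' A)} := fun k =>
    Nat.rec ⟨univ, by rwa [image_univ]⟩ (fun k A => ⟨A.1 ∩ {σ | σ k ≤ v k A}, hv k A⟩) k
  have hB : ∀ k, (B k).1 = {σ | ∀ i < k, σ i ≤ v i (B i)} := by
    intro k
    induction k with
    | zero => simp [B]
    | succ k ih =>
      change (B k).1 ∩ {σ | σ k ≤ v k (B k)} = _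
      rw [ih]
      ext σ
      simp only [mem_inter_iff, mem_ofPred_eq]
      exact Nat.forall_lt_succ_right.symm
  exact ⟨fun k => v k (B k), fun k => by rw [← hB k]; exact (B k).2⟩

lemma isCompact_setOf_forall_le (b : ℕ → ℕ) : IsCompact {σ : ℕ → ℕ | ∀ i, σ i ≤ b i} := by
  have h : IsCompact (univ.pi fun i => Iic (b i)) :=
    isCompact_univ_pi fun i => (finite_Iic (b i)).isCompact
  convert h using 1
  ext σ
  simp only [mem_ofPred_eq, Set.mem_pi, mem_univ, forall_const, mem_Iic]

/-- An open neighbourhood of a compact box in `ℕ → ℕ` contains a box with finitely many bounded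
coordinates. -/
lemma exists_box_subset {b : ℕ → ℕ} {V : Set (ℕ → ℕ)} (hV : IsOpen V)
    (hb : {σ | ∀ i, σ i ≤ b i} ⊆ V) : ∃ k, {σ : ℕ → ℕ | ∀ i < k, σ i ≤ b i} ⊆ V := by
  let _ := PiNat.metricSpaceNatNat
  obtain ⟨ε, hε, hsub⟩ := (isCompact_setOf_forall_le b).exists_thickening_subset_open hV hb
  obtain ⟨k, hk⟩ := exists_pow_lt_of_lt_one hε (by norm_num : (1 / 2 : ℝ) < 1)
  -- Truncating `σ` by `b` lands in the compact box and changes no coordinate below `k`.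
  refine ⟨k, fun σ hσ => hsub (Metric.mem_thickening_iff.2 ⟨fun i => min (σ i) (b i),
    fun i => min_le_right _ _, lt_of_le_of_lt ?_ hk⟩)⟩
  exact PiNat.mem_cylinder_iff_dist_le.1 fun i hi => (min_eq_left (hσ i hi)).symm

/-- Inner approximation of continuous images of `ℕ → ℕ` by compact sets, for the outer
regularization of a set function which is continuous along increasing sequences. -/
lemma exists_isCompact_forall_isOpen_lt {X : Type*} [TopologicalSpace X] {M : Set X → ℝ≥0∞}
    (hmono : ∀ ⦃A B⦄, A ⊆ B → M A ≤ M B)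
    (hM : ∀ (A : ℕ → Set X) (r : ℝ≥0∞), Monotone A → (∀ k, M (A k) ≤ r) → M (⋃ k, A k) ≤ r)
    {f : (ℕ → ℕ) → X} (hf : Continuous f) {a : ℝ≥0∞} (ha : a < M (range f)) :
    ∃ K ⊆ range f, IsCompact K ∧ ∀ U, IsOpen U → K ⊆ U → a < M U := by
  obtain ⟨b, hb⟩ := exists_bounds_lt_image hM f ha
  refine ⟨f '' {σ | ∀ i, σ i ≤ b i}, image_subset_range _ _,
    (isCompact_setOf_forall_le b).image hf, fun U hU hKU => ?_⟩
  obtain ⟨k, hk⟩ := exists_box_subset (hU.preimage hf) (image_subset_iff.1 hKU)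
  exact (hb k).trans_le (hmono (image_subset_iff.2 hk))

end Capacity

/-! ### From discrete masses to a limiting measure. -/

section Limit

variable {X κ : Type*} [MetricSpace X] [MeasurableSpace X] [BorelSpace X] [MeasurableSpace κ]
  {c : ℕ → X → κ} {ρ : Measure (ℕ × κ)}

/-- Point masses, one in each level-`m` cell meeting `K`. An atom in `O` has its whole cell inside
`c j ⁻¹' F` because `j ≤ m`. Open `O` are used since upper bounds on open sets survive weak limits.
-/
lemma IsRefining.exists_probabilityMeasure_approx [DiscreteMeasurableSpace (ℕ × κ)]
    (hc : IsRefining c) {K : Set X} (h0 : cellContent c ρ K ≠ 0)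
    (htop : cellContent c ρ K ≠ ∞) (m : ℕ) (hfin : (c m '' K).Finite) :
    ∃ ν : ProbabilityMeasure K, ∀ O : Set X, IsOpen O → ∀ j ≤ m, ∀ F : Set κ, O ⊆ c j ⁻¹' F →
      cellContent c ρ K * (ν : Measure K) (Subtype.val ⁻¹' O) ≤ cellContent c ρ (c j ⁻¹' F) := by
  classical
  have hK : K.Nonempty := by
    rw [nonempty_iff_ne_empty]
    rintro rfl
    exact h0 (nonpos_iff_eq_zero.1
      ((cellContent_le (empty_subset _)).trans (measure_empty (μ := ρ)).le))
  set P := hfin.toFinset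
  have hx : ∀ k, ∃ x : K, k ∈ P → c m x = k := by
    intro k
    by_cases hk : k ∈ P
    · obtain ⟨x, hx, hxk⟩ := hfin.mem_toFinset.1 hk
      exact ⟨⟨x, hx⟩, fun _ => hxk⟩
    · exact ⟨⟨hK.some, hK.some_mem⟩, fun h => absurd h hk⟩
  choose x hx using hx
  have hPK : (⋃ k ∈ P, K ∩ c m ⁻¹' {k}) = K := by
    refine Subset.antisymm (iUnion₂_subset fun k _ => inter_subset_left) fun y hy => ?_
    exact mem_biUnion (x := c m y) (hfin.mem_toFinset.2 (mem_image_of_mem _ hy)) ⟨hy, rfl⟩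
  obtain ⟨a, ha, ha'⟩ := hc.exists_mass_le_cellContent (ρ := ρ) (fun k => K ∩ c m ⁻¹' {k}) P
    (by rwa [hPK])
  rw [hPK] at ha
  set μ : Measure K := ∑ k ∈ P, a k • Measure.dirac (x k)
  have hμ : ∀ B : Set K, MeasurableSet B → μ B = ∑ k ∈ P with x k ∈ B, a k := by
    intro B hB
    simp only [μ, Measure.coe_finsetSum, Finset.sum_apply, Measure.smul_apply, smul_eq_mul,
      Measure.dirac_apply' _ hB, Finset.sum_filter]
    refine Finset.sum_congr rfl fun k _ => ?_
    by_cases h : x k ∈ B <;> simp [h]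
  have hμ1 : IsProbabilityMeasure ((cellContent c ρ K)⁻¹ • μ) := by
    constructor
    rw [Measure.smul_apply, smul_eq_mul, hμ univ MeasurableSet.univ]
    simp [ha, ENNReal.inv_mul_cancel h0 htop]
  refine ⟨⟨_, hμ1⟩, fun O hO j hj F hF => ?_⟩
  have hOm : MeasurableSet (Subtype.val ⁻¹' O : Set K) := measurable_subtype_coe hO.measurableSet
  rw [ProbabilityMeasure.coe_mk, Measure.smul_apply, smul_eq_mul, ← mul_assoc,
    ENNReal.mul_inv_cancel h0 htop, one_mul, hμ _ hOm]
  refine (ha' _ (Finset.filter_subset _ _)).trans (cellContent_mono (iUnion₂_subset ?_))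
  rintro k hk y ⟨-, hy⟩
  obtain ⟨hkP, hkO⟩ := Finset.mem_filter.1 hk
  have hyk : c m y = c m (x k) := (show c m y = k from hy).trans (hx k hkP).symm
  have := hF hkO
  rw [mem_preimage] at this ⊢
  rwa [hc hj hyk]

/-- A compact set of positive finite content carries a probability measure dominated by the
normalized content. -/
lemma IsRefining.exists_probabilityMeasure_le [DiscreteMeasurableSpace (ℕ × κ)]
    (hc : IsRefining c) {K : Set X} (hK : IsCompact K) (h0 : cellContent c ρ K ≠ 0)
    (htop : cellContent c ρ K ≠ ∞) (hfin : ∀ m, (c m '' K).Finite) :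
    ∃ ν : Measure X, IsProbabilityMeasure ν ∧ ν K = 1 ∧
      ∀ O : Set X, IsOpen O → ∀ (j : ℕ) (F : Set κ), O ⊆ c j ⁻¹' F →
        cellContent c ρ K * ν O ≤ cellContent c ρ (c j ⁻¹' F) := by
  have : CompactSpace K := isCompact_iff_compactSpace.1 hK
  choose ν hν using fun m => hc.exists_probabilityMeasure_approx h0 htop m (hfin m)
  obtain ⟨ν', -, hlim⟩ := isCompact_univ.ultrafilter_le_nhds ((hyperfilter ℕ).map ν) (by simp)
  have hlim : Tendsto ν (hyperfilter ℕ) (𝓝 ν') := hlim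
  have hval : Measurable (Subtype.val : K → X) := measurable_subtype_coe
  refine ⟨(ν' : Measure K).map Subtype.val, Measure.isProbabilityMeasure_map hval.aemeasurable,
    ?_, fun O hO j F hF => ?_⟩
  · rw [Measure.map_apply hval hK.measurableSet]
    simp
  · rw [Measure.map_apply hval hO.measurableSet, mul_comm, ← ENNReal.le_div_iff_mul_le
      (Or.inl h0) (Or.inl htop)]
    refine (ProbabilityMeasure.le_liminf_measure_open_of_tendsto hlim
      (hO.preimage continuous_subtype_val)).trans ?_
    refine (liminf_le_liminf (v := fun _ => cellContent c ρ (c j ⁻¹' F) / cellContent c ρ K)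
      ?_).trans (liminf_const _).le
    filter_upwards [(Nat.hyperfilter_le_atTop) (eventually_ge_atTop j)] with m hm
    rw [ENNReal.le_div_iff_mul_le (Or.inl h0) (Or.inl htop), mul_comm]
    exact hν m O hO j hm F hF

end Limit

/-! ### Dyadic cubes, their cost and their neighbourhoods. -/

section Dyadic

variable {n : ℕ}

/-- The index of the half-open dyadic cube of side `2⁻ʲ` containing `x`. -/
noncomputable def dyadicIndex (j : ℕ) (x : EuclideanSpace ℝ (Fin n)) : Fin n → ℤ :=
  fun i => ⌊(2 : ℝ) ^ j * x i⌋

lemma isRefining_dyadicIndex :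
    IsRefining (dyadicIndex : ℕ → EuclideanSpace ℝ (Fin n) → Fin n → ℤ) := by
  intro i j hij x y hxy
  have key : ∀ t : ℝ, ⌊(2 : ℝ) ^ i * t⌋ = ⌊(2 : ℝ) ^ j * t⌋ / ((2 ^ (j - i) : ℕ) : ℤ) := by
    intro t
    rw [← Int.floor_div_natCast]
    congr 1
    obtain ⟨d, rfl⟩ := Nat.exists_eq_add_of_le hij
    rw [Nat.add_sub_cancel_left, pow_add]
    push_cast
    field_simp
  funext l
  simp only [dyadicIndex, key]
  rw [show ⌊(2 : ℝ) ^ j * x l⌋ = ⌊(2 : ℝ) ^ j * y l⌋ from congrFun hxy l]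

lemma measurable_dyadicIndex (j : ℕ) :
    Measurable (dyadicIndex j : EuclideanSpace ℝ (Fin n) → Fin n → ℤ) := by
  refine measurable_pi_lambda _ fun i => Int.measurable_floor.comp ?_
  fun_prop

lemma finite_dyadicIndex_image {K : Set (EuclideanSpace ℝ (Fin n))} (hK : Bornology.IsBounded K)
    (j : ℕ) : (dyadicIndex j '' K).Finite := by
  obtain ⟨R, hR⟩ := hK.exists_norm_le
  refine (finite_Icc (fun _ : Fin n => ⌊(2 : ℝ) ^ j * (-R)⌋) fun _ => ⌊(2 : ℝ) ^ j * R⌋).subset ?_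
  rintro _ ⟨x, hx, rfl⟩
  have h : ∀ i, |x i| ≤ R := fun i => (PiLp.norm_apply_le x i).trans (hR x hx)
  exact ⟨fun i => Int.floor_le_floor (by gcongr; exact (abs_le.1 (h i)).1),
    fun i => Int.floor_le_floor (by gcongr; exact (abs_le.1 (h i)).2)⟩

lemma mem_dyadicCube_dyadicIndex (j : ℕ) (x : EuclideanSpace ℝ (Fin n)) :
    x ∈ dyadicCube (j : ℤ) (dyadicIndex j x) := by
  intro i
  have h2 : (0 : ℝ) < 2 ^ j := by positivity
  rw [zpow_neg, zpow_natCast, ← div_eq_mul_inv, ← div_eq_mul_inv, div_le_iff₀' h2, le_div_iff₀' h2]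
  exact ⟨Int.floor_le _, (Int.lt_floor_add_one _).le⟩

lemma isCompact_dyadicCube (j : ℤ) (k : Fin n → ℤ) : IsCompact (dyadicCube j k) := by
  have h : IsCompact (Icc (fun i => (k i : ℝ) * 2 ^ (-j)) fun i => ((k i : ℝ) + 1) * 2 ^ (-j)) :=
    isCompact_Icc
  convert (EuclideanSpace.equiv (Fin n) ℝ).toHomeomorph.isCompact_preimage.2 h using 1
  ext x
  simp [dyadicCube, Pi.le_def, forall_and]

lemma diam_dyadicCube (j : ℤ) (k : Fin n → ℤ) :
    Metric.diam (dyadicCube j k) = Metric.diam (dyadicCube j (0 : Fin n → ℤ)) := by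
  rw [← (IsometryEquiv.addRight (WithLp.toLp 2 fun i => (k i : ℝ) * 2 ^ (-j) :
    EuclideanSpace ℝ (Fin n))).diam_image (dyadicCube j 0)]
  congr 1
  ext x
  rw [← IsometryEquiv.coe_toEquiv, Equiv.image_eq_preimage_symm]
  simp [dyadicCube, add_mul, add_comm]

lemma diam_dyadicCube_zero_le {j : ℤ} (hj : j ≤ 0) (k l : Fin n → ℤ) :
    Metric.diam (dyadicCube 0 k) ≤ Metric.diam (dyadicCube j l) := by
  rw [diam_dyadicCube 0, diam_dyadicCube j]
  refine Metric.diam_mono (fun x hx i => ?_) (isCompact_dyadicCube j 0).isBounded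
  have h1 : (1 : ℝ) ≤ 2 ^ (-j) := one_le_zpow₀ one_le_two (by omega)
  have := hx i
  simp only [Pi.zero_apply, Int.cast_zero, zero_mul, neg_zero, zpow_zero, zero_add, one_mul] at this ⊢
  exact ⟨this.1, this.2.trans h1⟩

/-- The cost of a family of dyadic cubes of side at most one. -/
noncomputable def dyadicCost (n : ℕ) (h : ℝ → ℝ) : Measure (ℕ × (Fin n → ℤ)) :=
  Measure.sum fun q =>
    ENNReal.ofReal (h (Metric.diam (dyadicCube (q.1 : ℤ) q.2))) • Measure.dirac q

variable {h : ℝ → ℝ}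

lemma dyadicCost_apply (S : Set (ℕ × (Fin n → ℤ))) :
    dyadicCost n h S
      = ∑' q, S.indicator (fun q => ENNReal.ofReal (h (Metric.diam (dyadicCube (q.1 : ℤ) q.2)))) q := by
  rw [dyadicCost, Measure.sum_apply _ MeasurableSet.of_discrete]
  refine tsum_congr fun q => ?_
  by_cases hq : q ∈ S <;> simp [hq]

lemma dyadicCost_singleton (q : ℕ × (Fin n → ℤ)) :
    dyadicCost n h {q} = ENNReal.ofReal (h (Metric.diam (dyadicCube (q.1 : ℤ) q.2))) := by
  rw [dyadicCost_apply, tsum_eq_single q] <;> simp +contextual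

lemma hausdorffPre_eq_zero_of_cellContent_eq_zero (h_mono : MonotoneOn h (Ici 0)) (h_zero : h 0 = 0)
    {E : Set (EuclideanSpace ℝ (Fin n))} (hE : cellContent dyadicIndex (dyadicCost n h) E = 0)
    {δ : ℝ} (hδ : 0 < δ) : hausdorffPre h δ E = 0 := by
  classical
  -- If `h δ ≤ 0`, countably many balls of diameter at most `δ` cover the space for free. Otherwise
  -- a cover of cost below `h δ` can only use cubes of diameter at most `δ`, by monotonicity.
  rcases le_or_gt (h δ) 0 with hh | hh
  · refine nonpos_iff_eq_zero.1 ((iInf_le_of_le (fun i =>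
      Metric.closedBall (TopologicalSpace.denseSeq (EuclideanSpace ℝ (Fin n)) i) (δ / 2))
      (iInf₂_le_of_le (fun i => ?_) ?_ ?_)))
    · refine Metric.ediam_le_of_forall_dist_le fun x hx y hy => ?_
      have := dist_triangle_right x y
        (TopologicalSpace.denseSeq (EuclideanSpace ℝ (Fin n)) i)
      rw [Metric.mem_closedBall] at hx hy
      linarith
    · intro x _
      obtain ⟨i, hi⟩ := (TopologicalSpace.denseRange_denseSeq
        (EuclideanSpace ℝ (Fin n))).exists_dist_lt x (half_pos hδ)
      exact mem_iUnion.2 ⟨i, Metric.mem_closedBall.2 hi.le⟩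
    · refine (ENNReal.tsum_eq_zero.2 fun i => ENNReal.ofReal_eq_zero.2 (le_trans ?_ hh)).le
      refine h_mono Metric.diam_nonneg hδ.le ?_
      refine (Metric.diam_closedBall (half_pos hδ).le).trans (by linarith)
  · refine nonpos_iff_eq_zero.1 (le_of_forall_gt fun ε hε => ?_)
    obtain ⟨S, hS, hcost⟩ := exists_cover_lt (c := dyadicIndex) (ρ := dyadicCost n h) (A := E)
      (r := min ε (ENNReal.ofReal (h δ))) (by rw [hE]; exact lt_min hε (ENNReal.ofReal_pos.2 hh))
    set s : ℕ × (Fin n → ℤ) → Set (EuclideanSpace ℝ (Fin n)) :=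
      fun q => if q ∈ S then dyadicCube (q.1 : ℤ) q.2 else ∅
    let _ : Encodable (ℕ × (Fin n → ℤ)) := Encodable.ofCountable _
    refine lt_of_le_of_lt ?_ (hcost.trans_le (min_le_left _ _))
    refine iInf_le_of_le (fun i => ⋃ q ∈ Encodable.decode₂ (ℕ × (Fin n → ℤ)) i, s q)
      (iInf₂_le_of_le (fun i => ?_) ?_ ?_)
    · refine Encodable.iUnion_decode₂_cases (C := fun A => Metric.ediam A ≤ ENNReal.ofReal δ)
        (by simp) fun q => ?_
      by_cases hq : q ∈ S
      · have h1 : dyadicCost n h {q} < ENNReal.ofReal (h δ) :=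
          (measure_mono (singleton_subset_iff.2 hq)).trans_lt (hcost.trans_le (min_le_right _ _))
        rw [dyadicCost_singleton, ENNReal.ofReal_lt_ofReal_iff hh] at h1
        have h2 : Metric.diam (dyadicCube (q.1 : ℤ) q.2) ≤ δ := by
          by_contra! hlt
          exact h1.not_ge (h_mono hδ.le Metric.diam_nonneg hlt.le)
        simp only [s, hq, if_true]
        rw [← ENNReal.ofReal_toReal (isCompact_dyadicCube (q.1 : ℤ) q.2).isBounded.ediam_ne_top]
        exact ENNReal.ofReal_le_ofReal h2
      · simp [s, hq]
    · rw [Encodable.iUnion_decode₂]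
      intro x hx
      obtain ⟨j, hj⟩ := hS hx
      refine mem_iUnion.2 ⟨(j, dyadicIndex j x), ?_⟩
      simp only [s, hj, if_true]
      exact mem_dyadicCube_dyadicIndex j x
    · rw [tsum_iUnion_decode₂ (fun A => ENNReal.ofReal (h (Metric.diam A))) (by simp [h_zero]) s,
        dyadicCost_apply]
      refine ENNReal.tsum_le_tsum fun q => ?_
      by_cases hq : q ∈ S <;> simp [s, hq, h_zero]

/-- The indices of the dyadic cubes of a given side which touch the one with index `k`. -/
noncomputable def dyadicNeighbors (k : Fin n → ℤ) : Finset (Fin n → ℤ) :=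
  Fintype.piFinset fun i => Finset.Icc (k i - 1) (k i + 1)

/-- An open neighbourhood of a dyadic cube covered by the neighbouring cubes. -/
def dyadicNhd (j : ℕ) (k : Fin n → ℤ) : Set (EuclideanSpace ℝ (Fin n)) :=
  {x | ∀ i, (k i : ℝ) - 1 < 2 ^ j * x i ∧ 2 ^ j * x i < k i + 2}

lemma isOpen_dyadicNhd (j : ℕ) (k : Fin n → ℤ) : IsOpen (dyadicNhd j k) := by
  simp only [dyadicNhd, ofPred_forall]
  refine isOpen_iInter_of_finite fun i => ?_
  have hx : Continuous fun x : EuclideanSpace ℝ (Fin n) => (2 : ℝ) ^ j * x i := by fun_prop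
  exact (isOpen_lt continuous_const hx).inter (isOpen_lt hx continuous_const)

lemma dyadicCube_subset_dyadicNhd (j : ℕ) (k : Fin n → ℤ) :
    dyadicCube (j : ℤ) k ⊆ dyadicNhd j k := by
  intro x hx i
  have h2 : (0 : ℝ) < 2 ^ j := by positivity
  have := hx i
  rw [zpow_neg, zpow_natCast, ← div_eq_mul_inv, ← div_eq_mul_inv, div_le_iff₀' h2,
    le_div_iff₀' h2] at this
  constructor <;> linarith [this.1, this.2]

lemma dyadicNhd_subset (j : ℕ) (k : Fin n → ℤ) :
    dyadicNhd j k ⊆ dyadicIndex j ⁻¹' (dyadicNeighbors k : Set (Fin n → ℤ)) := by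
  intro x hx
  simp only [mem_preimage, Finset.mem_coe, dyadicNeighbors, Fintype.mem_piFinset, Finset.mem_Icc,
    dyadicIndex]
  intro i
  obtain ⟨h1, h2⟩ := hx i
  constructor
  · rw [Int.le_floor]
    push_cast
    exact h1.le
  · rw [← Int.lt_add_one_iff, Int.floor_lt]
    push_cast
    linarith

lemma dyadicCost_neighbors (j : ℕ) (k : Fin n → ℤ) :
    dyadicCost n h (Prod.mk j '' (dyadicNeighbors k : Set (Fin n → ℤ)))
      = 3 ^ n * ENNReal.ofReal (h (Metric.diam (dyadicCube (j : ℤ) k))) := by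
  classical
  have hcard : (dyadicNeighbors k).card = 3 ^ n := by
    simp [dyadicNeighbors, Fintype.card_piFinset, show ∀ a : ℤ, a + 1 + 1 - (a - 1) = 3 by intro; ring]
  have himg : Prod.mk j '' (dyadicNeighbors k : Set (Fin n → ℤ))
      = ⋃ l ∈ dyadicNeighbors k, {(j, l)} := by
    ext; simp [eq_comm]
  rw [himg, measure_biUnion_finset (by intro a _ b _ hab; simpa using hab)
    fun _ _ => MeasurableSet.of_discrete]
  simp only [dyadicCost_singleton]
  rw [Finset.sum_congr rfl fun l _ => by rw [diam_dyadicCube _ l, ← diam_dyadicCube _ k]]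
  simp [hcard]

lemma preimage_subset_cellUnion {X κ : Type*} (c : ℕ → X → κ) (j : ℕ) (F : Set κ) :
    c j ⁻¹' F ⊆ cellUnion c (Prod.mk j '' F) := fun x hx => ⟨j, c j x, hx, rfl⟩

lemma cellContent_iUnion_dyadicNhd_le (S : Set (ℕ × (Fin n → ℤ))) :
    cellContent dyadicIndex (dyadicCost n h) (⋃ q ∈ S, dyadicNhd q.1 q.2)
      ≤ 3 ^ n * dyadicCost n h S := by
  have hsub : ⋃ q ∈ S, dyadicNhd q.1 q.2 ⊆ cellUnion dyadicIndex
      (⋃ q ∈ S, Prod.mk q.1 '' (dyadicNeighbors q.2 : Set (Fin n → ℤ))) := by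
    refine iUnion₂_subset fun q hq x hx => ⟨q.1, mem_iUnion₂.2 ⟨q, hq, ?_⟩⟩
    exact mem_image_of_mem _ (dyadicNhd_subset q.1 q.2 hx)
  calc _ ≤ dyadicCost n h (⋃ q ∈ S, Prod.mk q.1 '' (dyadicNeighbors q.2 : Set (Fin n → ℤ))) :=
        cellContent_le hsub
    _ ≤ ∑' q : S, dyadicCost n h (Prod.mk q.1.1 '' (dyadicNeighbors q.1.2 : Set (Fin n → ℤ))) :=
        measure_biUnion_le _ S.to_countable _
    _ = 3 ^ n * dyadicCost n h S := by
        simp only [dyadicCost_neighbors]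
        rw [ENNReal.tsum_mul_left, dyadicCost_apply, ← tsum_subtype]

/-- Capacitability only bounds `M` from below on open sets containing `K`. If `K` had content zero,
a cheap cover enlarged to neighbouring cubes would give such an open set of content at most `a`. -/
lemma exists_isCompact_cellContent_ne_zero {E : Set (EuclideanSpace ℝ (Fin n))}
    (hE : AnalyticSet E) (h0 : cellContent dyadicIndex (dyadicCost n h) E ≠ 0) :
    ∃ K ⊆ E, IsCompact K ∧ cellContent dyadicIndex (dyadicCost n h) K ≠ 0 := by
  rw [AnalyticSet] at hE
  rcases hE with rfl | ⟨f, hf, rfl⟩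
  · exact absurd (nonpos_iff_eq_zero.1 ((cellContent_le (empty_subset _)).trans
      (measure_empty (μ := dyadicCost n h)).le)) h0
  obtain ⟨a, ha0, ha⟩ := exists_between (pos_iff_ne_zero.2 h0)
  obtain ⟨K, hKE, hK, hKU⟩ := exists_isCompact_forall_isOpen_lt
    (M := cellContent dyadicIndex (dyadicCost n h)) (fun _ _ => cellContent_mono)
    (fun A r hA hr => isRefining_dyadicIndex.cellContent_iUnion_le hA hr) hf ha
  refine ⟨K, hKE, hK, fun hK0 => ?_⟩
  obtain ⟨S, hS, hcost⟩ := exists_cover_lt (c := dyadicIndex) (ρ := dyadicCost n h) (A := K)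
    (r := a / 3 ^ n) (by rw [hK0]; exact ENNReal.div_pos ha0.ne' (by finiteness))
  refine (hKU (⋃ q ∈ S, dyadicNhd q.1 q.2)
    (isOpen_biUnion fun q _ => isOpen_dyadicNhd q.1 q.2) fun x hx => ?_).not_ge ?_
  · obtain ⟨j, hj⟩ := hS hx
    exact mem_biUnion hj (dyadicCube_subset_dyadicNhd j _ (mem_dyadicCube_dyadicIndex j x))
  · refine (cellContent_iUnion_dyadicNhd_le S).trans ((mul_le_mul_right hcost.le _).trans ?_)
    exact ENNReal.mul_div_le

end Dyadic

/-! ### The Frostman measure. -/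

theorem mainTheorem5 (n : ℕ) (h : ℝ → ℝ)
    (h_cont : ContinuousOn h (Set.Ici 0)) (h_mono : MonotoneOn h (Set.Ici 0)) (h_zero : h 0 = 0)
    (E : Set (EuclideanSpace ℝ (Fin n))) (hE : MeasureTheory.AnalyticSet E)
    (hE_pos : 0 < generalizedHausdorff h E) :
    ∃ μ : MeasureTheory.Measure (EuclideanSpace ℝ (Fin n)),
      μ.Regular ∧ 0 < μ E ∧
        ∀ Q : Set (EuclideanSpace ℝ (Fin n)), IsDyadicCube Q →
          μ Q ≤ ENNReal.ofReal (h (Metric.diam Q)) := by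
  set M := cellContent (dyadicIndex (n := n)) (dyadicCost n h) with hM
  have hME : M E ≠ 0 := by
    intro h0
    refine hE_pos.ne' ?_
    simp only [generalizedHausdorff, ENNReal.iSup_eq_zero]
    exact fun δ hδ => hausdorffPre_eq_zero_of_cellContent_eq_zero h_mono h_zero h0 hδ
  -- Restricting to one unit cube bounds the total mass by the cost of that cube, which settles all
  -- cubes of side greater than one.
  obtain ⟨k, hk⟩ : ∃ k, M (E ∩ dyadicIndex 0 ⁻¹' {k}) ≠ 0 := by
    by_contra! hcon
    have := cellContent_iUnion_eq_zero hcon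
    rw [show ⋃ k, E ∩ dyadicIndex 0 ⁻¹' {k} = E by ext; simp] at this
    exact hME this
  have hEk : AnalyticSet (E ∩ dyadicIndex 0 ⁻¹' {k}) := by
    have := ((measurable_dyadicIndex (n := n) 0) (MeasurableSet.singleton k)).analyticSet
    rw [inter_eq_iInter]
    exact AnalyticSet.iInter fun b => by cases b <;> assumption
  obtain ⟨K, hKE, hK, hK0⟩ := exists_isCompact_cellContent_ne_zero hEk hk
  have hKle : M K ≤ ENNReal.ofReal (h (Metric.diam (dyadicCube 0 k))) := by
    have := cellContent_le (ρ := dyadicCost n h) ((hKE.trans inter_subset_right).trans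
      (preimage_subset_cellUnion dyadicIndex 0 {k}))
    rwa [image_singleton, dyadicCost_singleton] at this
  obtain ⟨ν, hν, hνK, hνO⟩ := isRefining_dyadicIndex.exists_probabilityMeasure_le hK hK0
    (ne_top_of_le_ne_top ENNReal.ofReal_ne_top hKle) (finite_dyadicIndex_image hK.isBounded)
  have h3 : (3 ^ n : ℝ≥0∞) ≠ 0 := by positivity
  have h3' : (3 ^ n : ℝ≥0∞) ≠ ∞ := by finiteness
  have hMK : M K / 3 ^ n ≠ ∞ :=
    ENNReal.div_ne_top (ne_top_of_le_ne_top ENNReal.ofReal_ne_top hKle) h3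
  have hfin : IsFiniteMeasure ((M K / 3 ^ n) • ν) := ν.smul_finite hMK
  refine ⟨(M K / 3 ^ n) • ν, inferInstance, ?_, ?_⟩
  · refine lt_of_lt_of_le ?_ (measure_mono (hKE.trans inter_subset_left))
    rw [Measure.smul_apply, hνK, smul_eq_mul, mul_one]
    exact ENNReal.div_pos hK0 h3'
  · rintro _ ⟨j, l, rfl⟩
    rw [Measure.smul_apply, smul_eq_mul]
    rcases le_or_gt 0 j with hj | hj
    · lift j to ℕ using hj
      refine (mul_le_mul_right (measure_mono (dyadicCube_subset_dyadicNhd j l)) _).trans ?_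
      rw [ENNReal.mul_comm_div, ← mul_div_assoc]
      refine ENNReal.div_le_of_le_mul' ?_
      refine (hνO _ (isOpen_dyadicNhd j l) j _ (dyadicNhd_subset j l)).trans ?_
      rw [← dyadicCost_neighbors]
      exact cellContent_le (preimage_subset_cellUnion _ _ _)
    · calc M K / 3 ^ n * ν (dyadicCube j l) ≤ M K / 1 * 1 := by
            gcongr
            · exact_mod_cast Nat.one_le_pow n 3 (by norm_num)
            · exact prob_le_one
        _ ≤ ENNReal.ofReal (h (Metric.diam (dyadicCube 0 k))) := by simpa using hKle
        _ ≤ _ := ENNReal.ofReal_le_ofReal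
            (h_mono Metric.diam_nonneg Metric.diam_nonneg (diam_dyadicCube_zero_le hj.le k l))
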